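/- Consider a single-item auction with $n\ge 1$ bidders. Bidder $i$ has a value $v_i\in T_i\subseteq[0,H]$, where $H>0$, and bids $b_i\in[0,H]$. The item goes to a highest bidder, with ties broken uniformly at random: bidder $i$ receives it with probability $x_i(b)=\mathbb{I}[b_i=\max_j b_j]/|\arg\max_j b_j|$. Her payment is $p_i(b)=x_i(b)f_i(b_i)+g_i(b_i)$, where $f_i,g_i:[0,H]\to[0,H]$ are arbitrary functions, and her ex post utility is $U_i(v_i,b)=v_ix_i(b)-p_i(b)$. A joint bidding strategy $s=(s_1,\dots,s_n)$, $s_i:T_i\to[0,H]$, is monotone if every $s_i$ is weakly increasing. For a product distribution $D=\prod_i D_i$ on $\prod_i T_i$ write $$u_i^D(v_i,b_i,s_{-i})=\mathbb{E}_{v_{-i}\sim\prod_{j\ne i}D_j}\big[U_i(v_i,b_i,s_{-i}(v_{-i}))\big].$$ Given samples $v^{(1)},\dots,v^{(m)}$, let $\hat D=\prod_i\hat D_i$ be the empirical product distribution, where $\hat D_i$ is the uniform distribution over $v_i^{(1)},\dots,v_i^{(m)}$ (with multiplicity). **Theorem.** There is a universal constant $C>0$ such that for all $n\ge1$, $H>0$,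 $\varepsilon>0$ and $\delta\in(0,1)$ there is $$M\le C\,\frac{H^2}{\varepsilon^2}\left[n\log n\cdot\max\Big\{1,\log\frac H\varepsilon\Big\}+\log\frac n\delta\right]$$ with the following property. For all $T_1,\dots,T_n\subseteq[0,H]$, all $f_i,g_i$ as above, every integer $m\ge M$ and every product distribution $D$ on $\prod_iT_i$, with probability at least $1-\delta$ over $m$ independent samples from $D$, $$\big|u_i^{\hat D}(v_i,s_i(v_i),s_{-i})-u_i^{D}(v_i,s_i(v_i),s_{-i})\big|<\varepsilon$$ holds simultaneously for all monotone joint bidding strategies $s$, all bidders $i$ and all values $v_i\in T_i$. (For $\varepsilon\le H/e$ the maximum is just $\log(H/\varepsilon)$.) -/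

import Mathlib

open MeasureTheory

noncomputable section

/-- Bids are real numbers in `[0, H]`. -/
abbrev Bid (H : ℝ) : Type := Set.Icc (0 : ℝ) H

/-- A value profile, with bidder `j`'s value in the value space `T j`. -/
abbrev ValueProfile {n : ℕ} (T : Fin n → Set ℝ) : Type := ∀ j, T j

/-- A joint bidding strategy: bidder `j` maps her value in `T j` to a bid in `[0, H]`. -/
abbrev JointStrategy {n : ℕ} (T : Fin n → Set ℝ) (H : ℝ) : Type := ∀ j, T j → Bid H

/-- The functions `f i` and `g i`, both with values in `[0, H]`, that determine the payments
`p i b = x i b * f i (b i) + g i (b i)` of a single-item auction with `n` bidders. -/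
structure PaymentRule (n : ℕ) (H : ℝ) where
  f : Fin n → Bid H → ℝ
  g : Fin n → Bid H → ℝ
  f_mem : ∀ i b, f i b ∈ Set.Icc (0 : ℝ) H
  g_mem : ∀ i b, g i b ∈ Set.Icc (0 : ℝ) H

open Classical in
/-- The set of highest bidders. -/
def highestBidders {n : ℕ} {H : ℝ} (b : Fin n → Bid H) : Finset (Fin n) :=
  Finset.univ.filter fun k => ∀ j, b j ≤ b k

open Classical in
/-- The highest bidder wins, with ties broken uniformly at random: the probability with which
bidder `i` receives the item. -/
def allocation {n : ℕ} {H : ℝ} (i : Fin n) (b : Fin n → Bid H) : ℝ :=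
  if i ∈ highestBidders b then 1 / ((highestBidders b).card : ℝ) else 0

namespace PaymentRule

variable {n : ℕ} {H : ℝ}

/-- The payment of bidder `i`. -/
def payment (P : PaymentRule n H) (i : Fin n) (b : Fin n → Bid H) : ℝ :=
  allocation i b * P.f i (b i) + P.g i (b i)

/-- The ex post utility of bidder `i` with value `v` under the bids `b`. -/
def exPostUtility (P : PaymentRule n H) (i : Fin n) (v : ℝ) (b : Fin n → Bid H) : ℝ :=
  v * allocation i b - P.payment i b

end PaymentRule

/-- The bid vector `(b_i, b_{-i})`. -/
def combineBids {n : ℕ} {H : ℝ} (i : Fin n) (bi : Bid H) (bo : {j : Fin n // j ≠ i} → Bid H) :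
    Fin n → Bid H :=
  fun j => if h : j = i then bi else bo ⟨j, h⟩

/-- The interim utility of bidder `i` with value `v` and bid `b`, when each other bidder `j` has
an independent value with law `D j` and uses the strategy `s j`: the expectation of the ex post
utility over the values of the other bidders, whose law is the product of the `D j`, `j ≠ i`. -/
def interimUtility {n : ℕ} {H : ℝ} {T : Fin n → Set ℝ} (P : PaymentRule n H)
    (D : ∀ j, Measure (T j)) (i : Fin n) (v : T i) (b : Bid H)
    (s : ∀ j : {j : Fin n // j ≠ i}, T j → Bid H) : ℝ :=
  ∫ w : (∀ j : {j : Fin n // j ≠ i}, T j),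
    P.exPostUtility i (v : ℝ) (combineBids i b fun j => s j (w j))
      ∂(Measure.pi fun j : {j : Fin n // j ≠ i} => D j)

/-- A joint bidding strategy is monotone if every individual strategy is weakly increasing. -/
def MonotoneStrategy {n : ℕ} {H : ℝ} {T : Fin n → Set ℝ} (s : JointStrategy T H) : Prop :=
  ∀ j, Monotone (s j)

/-- A utility estimation algorithm working on `m` samples: it maps the samples, a bidder, her
value, and a joint bidding strategy to an estimate of the interim utility. -/
abbrev UtilityEstimator {n : ℕ} (T : Fin n → Set ℝ) (H : ℝ) (m : ℕ) : Type :=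
  (Fin m → ValueProfile T) → ∀ i, T i → JointStrategy T H → ℝ

/-- The algorithm `A` `(ε, δ)`-estimates with `m` samples the utilities over the set `B` of joint
strategies: for every product value distribution, with probability at least `1 - δ` over `m`
independent samples, all estimates of interim utilities are within `ε`.  The probability statement
says that the failure event has (outer) measure at most `δ`, i.e. that the success event contains
a measurable event of probability at least `1 - δ`. -/
def EstimatesUtilities {n : ℕ} {H : ℝ} {T : Fin n → Set ℝ} (P : PaymentRule n H) {m : ℕ}
    (A : UtilityEstimator T H m) (ε δ : ℝ) (B : Set (JointStrategy T H)) : Prop :=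
  ∀ D : (∀ j, Measure (T j)), (∀ j, IsProbabilityMeasure (D j)) →
    (Measure.pi fun _ : Fin m => Measure.pi D)
      {S | ¬ ∀ s ∈ B, ∀ (i : Fin n) (v : T i),
        |A S i v s - interimUtility P D i v (s i v) (fun j => s j)| < ε} ≤ ENNReal.ofReal δ

/-- The empirical marginal of bidder `j`: the uniform distribution over the `m` sampled values of
bidder `j`, counted with multiplicity. -/
def empiricalMarginal {n m : ℕ} {T : Fin n → Set ℝ} (S : Fin m → ValueProfile T) (j : Fin n) :
    Measure (T j) :=
  (m : ENNReal)⁻¹ • ∑ k : Fin m, Measure.dirac (S k j)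

/-- The empirical product distribution estimator: the interim utility computed on the product of
the empirical marginals. -/
def empiricalProductEstimator {n : ℕ} {H : ℝ} {T : Fin n → Set ℝ} (P : PaymentRule n H) (m : ℕ) :
    UtilityEstimator T H m :=
  fun S i v s => interimUtility P (empiricalMarginal S) i v (s i v) (fun j => s j)

end

/-! The laws of the opponents' values enter an interim utility only through the winning probability,
whose coefficient `v - f i b` is at most `H` in absolute value. That probability is determined by
the lower sets `{s j < b}` and `{s j ≤ b}` and increases with each of them (`winProb_mono`).
Quantiles of `D j` bracket all lower sets by `K` pairs with gaps of mass at most `1 / K`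
(`exists_isLowerSet_brackets`), so passing to bracket ends changes the winning probability under `D`
by at most `2n / K`. The brackets depend on `D` but not on the samples, so a union bound over
`2nK^(2n)` fixed functions handles all monotone strategies at once.

For one fixed function, the empirical product integral is an average over tuples of sample indices.
Cyclic shifts of the tuples turn it into an average of sample means, each over `m` independent
profiles. These means are dependent, but averaging variables with a common sub-Gaussian parameter
preserves it, so Hoeffding's bound survives (`hasSubgaussianMGF_integral_empirical`). -/

noncomputable section

open ProbabilityTheory

/-! ### Hoeffding's inequality for the product of empirical marginals -/

/-- All entries `S k j` are independent and their laws depend only on `j`, so rotating each bidder's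
column separately is an injective reindexing that respects the laws. -/
theorem measurePreserving_pi_shift {ι : Type*} [Fintype ι] {Ω : ι → Type*}
    [∀ j, MeasurableSpace (Ω j)] (D : ∀ j, Measure (Ω j)) [∀ j, IsProbabilityMeasure (D j)]
    {m : ℕ} [NeZero m] (c : ι → Fin m) :
    MeasurePreserving (fun (S : Fin m → ∀ j, Ω j) k j => S (c j + k) j)
      (Measure.pi fun _ : Fin m => Measure.pi D) (Measure.pi fun _ : Fin m => Measure.pi D) := by
  refine ⟨by fun_prop, ?_⟩
  simp_rw [← Measure.infinitePi_eq_pi]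
  let σ : (_ : Fin m) × ι → (_ : Fin m) × ι := fun p => ⟨c p.2 + p.1, p.2⟩
  have hσ : Function.Injective σ := by
    rintro ⟨a, b⟩ ⟨a', b'⟩ h
    simp only [σ, Sigma.mk.injEq, heq_eq_eq] at h
    obtain ⟨h1, rfl⟩ := h
    simpa using h1
  have hP := Measure.map_infinitePi_infinitePi_of_inj
    (P := fun p : (_ : Fin m) × ι => D p.2) hσ
  have hQ := Measure.infinitePi_map_piCurry (fun (_ : Fin m) (j : ι) => D j)
  conv_lhs => rw [← hQ]
  rw [Measure.map_map (by fun_prop) (by fun_prop)]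
  conv_rhs => rw [← hQ]
  have hP' : (Measure.infinitePi fun p : (_ : Fin m) × ι => D p.2) =
      (Measure.infinitePi fun p : (_ : Fin m) × ι => D p.2).map
        (fun ω (p : (_ : Fin m) × ι) => (ω (σ p) : Ω p.2)) := hP.symm
  conv_rhs => rw [hP']
  rw [Measure.map_map (by fun_prop) (by fun_prop)]
  rfl

/-- Each empirical marginal is the image of the uniform law on `Fin m`, so their product is the
image of the uniform law on index tuples. -/
theorem integral_pi_empirical {ι : Type*} [Fintype ι] [DecidableEq ι] {Ω : ι → Type*}
    [∀ j, MeasurableSpace (Ω j)] {m : ℕ} [NeZero m] (S : Fin m → ∀ j, Ω j)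
    {h : (∀ j, Ω j) → ℝ} (hh : Measurable h) :
    ∫ v, h v ∂(Measure.pi fun j => (m : ENNReal)⁻¹ • ∑ k : Fin m, Measure.dirac (S k j)) =
      ((m : ℝ) ^ Fintype.card ι)⁻¹ * ∑ c : ι → Fin m, h fun j => S (c j) j := by
  have hm : (m : ENNReal) ≠ 0 := by exact_mod_cast NeZero.ne m
  let u : Measure (Fin m) := (m : ENNReal)⁻¹ • Measure.count
  have hu : IsFiniteMeasure u := by
    refine ⟨?_⟩
    simp only [u, Measure.smul_apply, smul_eq_mul, Measure.count_univ]
    exact ENNReal.mul_lt_top (ENNReal.inv_lt_top.2 (pos_iff_ne_zero.2 hm)) (by simp)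
  have hS : ∀ j, Measurable fun k => S k j := fun j => measurable_of_finite _
  have he : ∀ j, (m : ENNReal)⁻¹ • ∑ k : Fin m, Measure.dirac (S k j)
      = u.map fun k => S k j := by
    intro j
    simp only [u, Measure.map_smul, Measure.count, Measure.sum_fintype]
    congr 1
    rw [← Measure.mapₗ_apply_of_measurable (hS j), map_sum]
    refine Finset.sum_congr rfl fun k _ => ?_
    rw [Measure.mapₗ_apply_of_measurable (hS j), Measure.map_dirac' (hS j)]
  simp_rw [he]
  have hf : ∀ j, IsFiniteMeasure (u.map fun k => S k j) := fun j => inferInstance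
  rw [← Measure.pi_map_pi (fun j => (hS j).aemeasurable), integral_map
    (measurable_of_finite _).aemeasurable hh.aestronglyMeasurable, integral_fintype (Integrable.of_finite), Finset.mul_sum]
  refine Finset.sum_congr rfl fun c _ => ?_
  simp [measureReal_def, Measure.pi_singleton, u]

/-- Without independence the square roots of the parameters still add, whence the squared
cardinality; dividing the sum by `s.card` restores `a`. -/
theorem hasSubgaussianMGF_sum {Ω κ : Type*} [MeasurableSpace Ω] {μ : Measure Ω}
    [IsProbabilityMeasure μ] {X : κ → Ω → ℝ} {a : NNReal} (s : Finset κ)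
    (hX : ∀ c ∈ s, HasSubgaussianMGF (X c) a μ) :
    HasSubgaussianMGF (fun ω => ∑ c ∈ s, X c ω) ((s.card : NNReal) ^ 2 * a) μ := by
  classical
  induction s using Finset.induction_on with
  | empty => simp
  | insert c s hc ih =>
    have := (hX c (by simp)).add (ih fun d hd => hX d (by simp [hd]))
    simp_rw [Finset.sum_insert hc]
    convert! this using 1
    rw [NNReal.sqrt_mul, NNReal.sqrt_sq, Finset.card_insert_of_notMem hc, ← one_add_mul,
      mul_pow, NNReal.sq_sqrt]
    push_cast
    ring

/-- Hoeffding's bound for the empirical product measure: the integral of a function with values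
in `[0, 1]` against the product of the empirical marginals is sub-Gaussian around its mean, with
the same parameter as the average over the samples. -/
theorem hasSubgaussianMGF_integral_empirical {ι : Type*} [Fintype ι] [DecidableEq ι] {Ω : ι → Type*}
    [∀ j, MeasurableSpace (Ω j)] (D : ∀ j, Measure (Ω j)) [∀ j, IsProbabilityMeasure (D j)]
    {m : ℕ} [NeZero m] {h : (∀ j, Ω j) → ℝ} (hh : Measurable h)
    (h01 : ∀ v, h v ∈ Set.Icc (0 : ℝ) 1) :
    HasSubgaussianMGF (fun S : Fin m → ∀ j, Ω j =>
      ∫ v, h v ∂(Measure.pi fun j => (m : ENNReal)⁻¹ • ∑ k : Fin m, Measure.dirac (S k j))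
        - ∫ v, h v ∂(Measure.pi D)) ((4 * m : NNReal)⁻¹)
      (Measure.pi fun _ : Fin m => Measure.pi D) := by
  have hm : (m : ℝ) ≠ 0 := by exact_mod_cast NeZero.ne m
  set E := ∫ v, h v ∂(Measure.pi D)
  set Q := Measure.pi fun _ : Fin m => Measure.pi D
  have hbase : HasSubgaussianMGF (fun v => h v - E) ((‖(1 : ℝ) - 0‖₊ / 2) ^ 2) (Measure.pi D) :=
    hasSubgaussianMGF_of_mem_Icc hh.aemeasurable (ae_of_all _ h01)
  have hcoord : ∀ k : Fin m,
      HasSubgaussianMGF (fun S : Fin m → ∀ j, Ω j => h (S k) - E) ((‖(1 : ℝ) - 0‖₊ / 2) ^ 2) Q := by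
    intro k
    have hk := (measurePreserving_eval (fun _ : Fin m => Measure.pi D) k)
    exact HasSubgaussianMGF.of_map (Y := fun S : Fin m → ∀ j, Ω j => S k)
      (X := fun v => h v - E) hk.measurable.aemeasurable (by
        rw [show Measure.map (fun S : Fin m → ∀ j, Ω j => S k) Q = Measure.pi D from hk.map_eq]
        exact hbase)
  have hind : iIndepFun (fun (k : Fin m) (S : Fin m → ∀ j, Ω j) => h (S k) - E) Q :=
    iIndepFun_pi (X := fun _ v => h v - E) fun _ => (hh.sub_const E).aemeasurable
  have hsum := HasSubgaussianMGF.sum_of_iIndepFun hind (s := Finset.univ)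
    (c := fun _ => (‖(1 : ℝ) - 0‖₊ / 2) ^ 2) fun k _ => hcoord k
  have hshift : ∀ c : ι → Fin m, HasSubgaussianMGF
      (fun S : Fin m → ∀ j, Ω j => ∑ k : Fin m, (h (fun j => S (c j + k) j) - E))
      (∑ _k : Fin m, (‖(1 : ℝ) - 0‖₊ / 2) ^ 2) Q := by
    intro c
    have hc := measurePreserving_pi_shift D c
    refine HasSubgaussianMGF.of_map (Y := fun (S : Fin m → ∀ j, Ω j) k j => S (c j + k) j)
      (X := fun S : Fin m → ∀ j, Ω j => ∑ k : Fin m, (h (S k) - E)) hc.measurable.aemeasurable ?_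
    rw [hc.map_eq]
    exact hsum
  -- With `N = m ^ card ι` tuples, the parameter is `N² · (m / 4) / (N m)² = 1 / (4m)`.
  have htot := (hasSubgaussianMGF_sum Finset.univ fun c _ => hshift c).const_mul
    (((m : ℝ) ^ Fintype.card ι)⁻¹ * (m : ℝ)⁻¹)
  have hmN : (m : ℝ) ^ Fintype.card ι ≠ 0 := pow_ne_zero _ hm
  convert! htot using 1
  · ext S
    rw [integral_pi_empirical S hh, Finset.sum_comm]
    -- For fixed `k`, translation by the constant `k` permutes the tuples, so every `k` contributes
    -- the same full sum.
    have : ∀ k : Fin m, ∑ c : ι → Fin m, (h (fun j => S (c j + k) j) - E)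
        = ∑ c : ι → Fin m, h (fun j => S (c j) j) - (m : ℝ) ^ Fintype.card ι * E := by
      intro k
      rw [Finset.sum_sub_distrib]
      congr 1
      · exact Fintype.sum_equiv (Equiv.addRight fun _ => k) _ _ fun c => rfl
      · simp
    simp_rw [this]
    simp only [Finset.sum_const, Finset.card_univ, Fintype.card_fin, nsmul_eq_mul]
    field_simp
  · ext
    simp only [sub_zero, nnnorm_one, Finset.sum_const, Finset.card_univ, Fintype.card_fin,
      nsmul_eq_mul, Fintype.card_fun]
    refine Eq.trans ?_ (NNReal.coe_mul _ _).symm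
    change _ = (((m : ℝ) ^ Fintype.card ι)⁻¹ * (m : ℝ)⁻¹) ^ 2 * _
    push_cast
    field_simp
    ring

theorem measureReal_abs_integral_empirical_ge_le {ι : Type*} [Fintype ι] [DecidableEq ι] {Ω : ι → Type*}
    [∀ j, MeasurableSpace (Ω j)] (D : ∀ j, Measure (Ω j)) [∀ j, IsProbabilityMeasure (D j)]
    {m : ℕ} [NeZero m] {h : (∀ j, Ω j) → ℝ} (hh : Measurable h)
    (h01 : ∀ v, h v ∈ Set.Icc (0 : ℝ) 1) {η : ℝ} (hη : 0 ≤ η) :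
    (Measure.pi fun _ : Fin m => Measure.pi D).real
      {S | η ≤ |∫ v, h v ∂(Measure.pi fun j =>
          (m : ENNReal)⁻¹ • ∑ k : Fin m, Measure.dirac (S k j)) - ∫ v, h v ∂(Measure.pi D)|} ≤
      2 * Real.exp (-(2 * m * η ^ 2)) := by
  have key := hasSubgaussianMGF_integral_empirical (m := m) D hh h01
  have hm : (m : ℝ) ≠ 0 := by exact_mod_cast NeZero.ne m
  have e : -η ^ 2 / (2 * ((4 * m : NNReal)⁻¹ : NNReal)) = -(2 * m * η ^ 2) := by
    push_cast
    field_simp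
    ring
  have h1 := key.measure_ge_le hη
  have h2 := key.neg.measure_ge_le hη
  rw [e] at h1 h2
  refine (measureReal_mono ?_ (measure_ne_top _ _)).trans
    ((measureReal_union_le _ _).trans ((add_le_add h1 h2).trans_eq (two_mul _).symm))
  intro S hS
  simpa [le_abs] using hS

/-! ### Quantile brackets for lower sets -/

/-- Take the infimum of the points where the cdf reaches `p`: right continuity gives the second
bound, exhaustion from the left the first. An atom at `t` can make both strict. -/
theorem exists_quantile (ν : Measure ℝ) [IsProbabilityMeasure ν] {p : ℝ} (hp0 : 0 < p)
    (hp1 : p < 1) : ∃ t : ℝ, ν.real (Set.Iio t) ≤ p ∧ p ≤ ν.real (Set.Iic t) := by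
  let A : Set ℝ := {t | p ≤ cdf ν t}
  have hne : A.Nonempty :=
    (((tendsto_cdf_atTop ν).eventually (eventually_gt_nhds hp1)).exists).imp fun _ h => h.le
  have hbdd : BddBelow A := by
    obtain ⟨l, hl⟩ := ((tendsto_cdf_atBot ν).eventually (eventually_lt_nhds hp0)).exists
    refine ⟨l, fun t ht => ?_⟩
    by_contra hlt
    exact absurd (ht.trans (monotone_cdf ν (not_le.1 hlt).le)) (not_le.2 hl)
  have hlt : ∀ t < sInf A, cdf ν t ≤ p := fun t ht =>
    (not_le.1 fun h => notMem_of_lt_csInf ht hbdd h).le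
  refine ⟨sInf A, ?_, ?_⟩
  · have h0 : ν (Set.Iio (sInf A)) ≤ ENNReal.ofReal p := by
      obtain ⟨u, hu, hus, hut⟩ := exists_seq_strictMono_tendsto (sInf A)
      have hU : Set.Iio (sInf A) = ⋃ k, Set.Iic (u k) := by
        ext x
        simp only [Set.mem_Iio, Set.mem_iUnion, Set.mem_Iic]
        exact ⟨fun hx => ((hut.eventually (eventually_gt_nhds hx)).exists).imp fun _ h => h.le,
          fun ⟨k, hk⟩ => hk.trans_lt (hus k)⟩
      rw [hU, Monotone.measure_iUnion fun a b hab => Set.Iic_subset_Iic.2 (hu.monotone hab)]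
      refine iSup_le fun k => ?_
      rw [← ofReal_cdf]
      exact ENNReal.ofReal_le_ofReal (hlt _ (hus k))
    exact ENNReal.toReal_le_of_le_ofReal hp0.le h0
  · rw [← cdf_eq_real]
    have hr := (cdf ν).right_continuous (sInf A)
    refine ge_of_tendsto (hr.mono_left (nhdsWithin_mono _ Set.Ioi_subset_Ici_self)) ?_
    filter_upwards [self_mem_nhdsWithin] with x hx
    obtain ⟨t, ht, htx⟩ := exists_lt_of_csInf_lt hne hx
    exact (show p ≤ cdf ν t from ht).trans (monotone_cdf ν htx.le)

/-- `L` is the trace on `T` of its downward closure in `ℝ`, an order-connected set. -/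
theorem IsLowerSet.measurableSet_subtype {T : Set ℝ} {L : Set T} (hL : IsLowerSet L) :
    MeasurableSet L := by
  let U : Set ℝ := {x | ∃ y ∈ L, x ≤ y}
  have hU : U.OrdConnected := IsLowerSet.ordConnected fun a b hab ⟨y, hy, h⟩ => ⟨y, hy, hab.trans h⟩
  have : L = Subtype.val ⁻¹' U := by
    ext x
    exact ⟨fun hx => ⟨x, hx, le_rfl⟩, fun ⟨y, hy, h⟩ => hL (Subtype.coe_le_coe.1 h) hy⟩
  rw [this]
  exact measurable_subtype_coe hU.measurableSet

/-- The lower sets of a probability space on the line are covered by `K` brackets, each of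
probability at most `1 / K`. -/
theorem exists_isLowerSet_brackets {T : Set ℝ} (μ : Measure T) [IsProbabilityMeasure μ] {K : ℕ}
    (hK : 0 < K) : ∃ A B : Fin K → Set T, (∀ k, MeasurableSet (A k)) ∧ (∀ k, MeasurableSet (B k)) ∧
      (∀ k, μ.real (B k \ A k) ≤ 1 / K) ∧
      ∀ L : Set T, IsLowerSet L → ∃ k, A k ⊆ L ∧ L ⊆ B k := by
  have hKr : (0 : ℝ) < K := by exact_mod_cast hK
  have hν : IsProbabilityMeasure (μ.map Subtype.val) :=
    Measure.isProbabilityMeasure_map (by fun_prop)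
  have hq : ∀ k : ℕ, ∃ t : ℝ, 0 < k → k < K →
      (μ.map Subtype.val).real (Set.Iio t) ≤ (k : ℝ) / K ∧
        (k : ℝ) / K ≤ (μ.map Subtype.val).real (Set.Iic t) := by
    intro k
    by_cases h : 0 < k ∧ k < K
    · obtain ⟨t, ht⟩ := exists_quantile (μ.map Subtype.val) (p := (k : ℝ) / K)
        (div_pos (by exact_mod_cast h.1) hKr) ((div_lt_one hKr).2 (by exact_mod_cast h.2))
      exact ⟨t, fun _ _ => ht⟩
    · exact ⟨0, fun h1 h2 => (h ⟨h1, h2⟩).elim⟩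
  choose t ht using hq
  -- The empty set and the whole space replace the quantile sets at levels `0` and `1`, where no
  -- real quantile need exist.
  let a : ℕ → Set T := fun k => if k = 0 then ∅ else {x | (x : ℝ) ≤ t k}
  let b : ℕ → Set T := fun k => if k = K then Set.univ else {x | (x : ℝ) < t k}
  have ha : ∀ k, MeasurableSet (a k) := fun k => by
    simp only [a]
    split_ifs
    · exact MeasurableSet.empty
    · exact measurableSet_le (by fun_prop) (by fun_prop)
  have hb : ∀ k, MeasurableSet (b k) := fun k => by
    simp only [b]
    split_ifs
    · exact MeasurableSet.univ
    · exact measurableSet_lt (by fun_prop) (by fun_prop)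
  have hμa : ∀ k < K, (k : ℝ) / K ≤ μ.real (a k) := by
    intro k hk
    rcases Nat.eq_zero_or_pos k with rfl | h0
    · simp
    · have := (ht k h0 hk).2
      rw [map_measureReal_apply (by fun_prop) measurableSet_Iic] at this
      simp only [a, if_neg h0.ne']
      exact this
  have hμb : ∀ k, 0 < k → k ≤ K → μ.real (b k) ≤ (k : ℝ) / K := by
    intro k h0 hk
    rcases hk.eq_or_lt with rfl | hk
    · simp [b, div_self hKr.ne']
    · have := (ht k h0 hk).1
      rw [map_measureReal_apply (by fun_prop) measurableSet_Iio] at this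
      simp only [b, if_neg hk.ne]
      exact this
  have hal : ∀ k, IsLowerSet (a k) := fun k => by
    simp only [a]
    split_ifs
    · exact isLowerSet_empty
    · exact fun x y hyx hx => (Subtype.coe_le_coe.2 hyx).trans hx
  have hbl : ∀ k, IsLowerSet (b k) := fun k => by
    simp only [b]
    split_ifs
    · exact isLowerSet_univ
    · exact fun x y hyx hx => (Subtype.coe_le_coe.2 hyx).trans_lt hx
  refine ⟨fun k => a k, fun k => b (k + 1), fun k => ha k, fun k => hb _, fun k => ?_,
    fun L hL => ?_⟩
  -- Lower sets form a chain. The second case can occur when an atom makes consecutive quantiles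
  -- coincide.
  · rcases (hal k).total (hbl (k + 1)) with h | h
    · rw [measureReal_sdiff h (ha k)]
      have h1 := hμa k k.2
      have h2 := hμb (k + 1) k.1.succ_pos k.2
      push_cast at h2
      rw [add_div] at h2
      linarith
    · rw [Set.sdiff_eq_empty.2 h, measureReal_empty]
      positivity
  · classical
    -- For the last `k` with `a k ⊆ L`, a point of `a (k + 1)` outside `L` forces `L` strictly below
    -- `t (k + 1)`.
    let k := Nat.findGreatest (fun k => a k ⊆ L) (K - 1)
    have hk : k ≤ K - 1 := Nat.findGreatest_le _
    have hak : a k ⊆ L := Nat.findGreatest_spec (P := fun k => a k ⊆ L) (Nat.zero_le (K - 1))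
      (by simp [a])
    refine ⟨⟨k, by omega⟩, hak, ?_⟩
    change L ⊆ b (k + 1)
    by_cases hkK : k + 1 = K
    · simp [b, hkK]
    · have hnot : ¬ a (k + 1) ⊆ L := Nat.findGreatest_is_greatest (Nat.lt_succ_self k) (by omega)
      obtain ⟨x, hx, hxL⟩ := Set.not_subset.1 hnot
      simp only [a, Nat.succ_ne_zero, if_false, Set.mem_ofPred_eq] at hx
      intro y hy
      simp only [b, hkK, if_false, Set.mem_ofPred_eq]
      exact lt_of_lt_of_le (Subtype.coe_lt_coe.2 (not_le.1 fun h => hxL (hL h hy))) hx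

/-! ### Monotonicity and bracketing of the winning probability -/

/-- The probability that a bidder wins against opponents with values `w`, where opponent `j` bids
less than her on `L j` and at most as much as her on `L' j`. -/
def winProb {ι : Type*} [Fintype ι] {Ω : ι → Type*} (L L' : ∀ j, Set (Ω j)) (w : ∀ j, Ω j) : ℝ :=
  (∏ j, (L' j).indicator 1 (w j)) / (1 + ∑ j, (L j)ᶜ.indicator 1 (w j))

section WinProb

variable {ι : Type*} [Fintype ι] {Ω : ι → Type*}

theorem one_le_one_add_sum_indicator (L : ∀ j, Set (Ω j)) (w : ∀ j, Ω j) :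
    (1 : ℝ) ≤ 1 + ∑ j, (L j).indicator 1 (w j) :=
  le_add_of_nonneg_right <| Finset.sum_nonneg fun _ _ =>
    Set.indicator_nonneg (fun _ _ => zero_le_one) _

theorem prod_indicator_nonneg (L : ∀ j, Set (Ω j)) (w : ∀ j, Ω j) :
    (0 : ℝ) ≤ ∏ j, (L j).indicator 1 (w j) :=
  Finset.prod_nonneg fun _ _ => Set.indicator_nonneg (fun _ _ => zero_le_one) _

theorem winProb_mem_Icc (L L' : ∀ j, Set (Ω j)) (w : ∀ j, Ω j) :
    winProb L L' w ∈ Set.Icc (0 : ℝ) 1 := by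
  have h1 := one_le_one_add_sum_indicator (fun j => (L j)ᶜ) w
  refine ⟨div_nonneg (prod_indicator_nonneg L' w) (by linarith), div_le_one_of_le₀ ?_ (by linarith)⟩
  refine le_trans (Finset.prod_le_one
    (fun _ _ => Set.indicator_nonneg (fun _ _ => zero_le_one) _) fun j _ => ?_) h1
  exact Set.indicator_le_self' (fun _ _ => zero_le_one) _

theorem winProb_mono {A A' B B' : ∀ j, Set (Ω j)} (h : ∀ j, A j ⊆ B j) (h' : ∀ j, A' j ⊆ B' j)
    (w : ∀ j, Ω j) : winProb A A' w ≤ winProb B B' w := by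
  refine div_le_div₀ (prod_indicator_nonneg _ _) ?_
    (lt_of_lt_of_le one_pos (one_le_one_add_sum_indicator _ _)) ?_
  · exact Finset.prod_le_prod (fun _ _ => Set.indicator_nonneg (fun _ _ => zero_le_one) _)
      fun j _ => Set.indicator_le_indicator_of_subset (h' j) (fun _ => zero_le_one) _
  · gcongr 1 + ?_
    exact Finset.sum_le_sum fun j _ => Set.indicator_le_indicator_of_subset
      (Set.compl_subset_compl.2 (h j)) (fun _ => zero_le_one) _

/-- If `w` avoids all gaps the two values agree; otherwise the right side is at least `1`. -/
theorem winProb_sub_le {A A' B B' : ∀ j, Set (Ω j)} (h : ∀ j, A j ⊆ B j) (h' : ∀ j, A' j ⊆ B' j)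
    (w : ∀ j, Ω j) : winProb B B' w - winProb A A' w ≤
      ∑ j, ((B j \ A j).indicator 1 (w j) + (B' j \ A' j).indicator 1 (w j)) := by
  classical
  have hn : ∀ j, (0 : ℝ) ≤ (B j \ A j).indicator 1 (w j) := fun j =>
    Set.indicator_nonneg (fun _ _ => zero_le_one) _
  have hn' : ∀ j, (0 : ℝ) ≤ (B' j \ A' j).indicator 1 (w j) := fun j =>
    Set.indicator_nonneg (fun _ _ => zero_le_one) _
  by_cases hex : ∃ j, w j ∈ B j \ A j ∨ w j ∈ B' j \ A' j
  · obtain ⟨j, hj⟩ := hex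
    have h1 : (1 : ℝ) ≤ (B j \ A j).indicator 1 (w j) + (B' j \ A' j).indicator 1 (w j) := by
      rcases hj with hj | hj
      · have := hn' j
        rw [Set.indicator_of_mem hj, Pi.one_apply]
        linarith
      · have := hn j
        rw [Set.indicator_of_mem hj, Pi.one_apply]
        linarith
    have h2 := Finset.single_le_sum (f := fun j => (B j \ A j).indicator (1 : Ω j → ℝ) (w j) +
      (B' j \ A' j).indicator (1 : Ω j → ℝ) (w j))
      (fun j _ => add_nonneg (hn j) (hn' j)) (Finset.mem_univ j)
    linarith [(winProb_mem_Icc B B' w).2, (winProb_mem_Icc A A' w).1]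
  · push Not at hex
    have e : ∀ j, w j ∈ B j ↔ w j ∈ A j := fun j =>
      ⟨fun hb => by_contra fun ha => (hex j).1 ⟨hb, ha⟩, fun ha => h j ha⟩
    have e' : ∀ j, w j ∈ B' j ↔ w j ∈ A' j := fun j =>
      ⟨fun hb => by_contra fun ha => (hex j).2 ⟨hb, ha⟩, fun ha => h' j ha⟩
    have : winProb B B' w = winProb A A' w := by
      simp only [winProb, Set.indicator_apply, Set.mem_compl_iff, e, e']
    rw [this, sub_self]
    exact Finset.sum_nonneg fun j _ => add_nonneg (hn j) (hn' j)

variable [∀ j, MeasurableSpace (Ω j)]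

theorem measurable_winProb {L L' : ∀ j, Set (Ω j)} (hL : ∀ j, MeasurableSet (L j))
    (hL' : ∀ j, MeasurableSet (L' j)) : Measurable (winProb L L') := by
  have h1 : ∀ j, Measurable fun w : ∀ j, Ω j => (L' j).indicator (1 : Ω j → ℝ) (w j) := fun j =>
    (measurable_one.indicator (hL' j)).comp (measurable_pi_apply j)
  have h2 : ∀ j, Measurable fun w : ∀ j, Ω j => (L j)ᶜ.indicator (1 : Ω j → ℝ) (w j) := fun j =>
    (measurable_one.indicator (hL j).compl).comp (measurable_pi_apply j)
  exact (Finset.measurable_prod _ fun j _ => h1 j).div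
    (measurable_const.add (Finset.measurable_sum _ fun j _ => h2 j))

variable (D : ∀ j, Measure (Ω j)) [∀ j, IsProbabilityMeasure (D j)]

theorem integrable_winProb {L L' : ∀ j, Set (Ω j)} (hL : ∀ j, MeasurableSet (L j))
    (hL' : ∀ j, MeasurableSet (L' j)) : Integrable (winProb L L') (Measure.pi D) :=
  Integrable.of_mem_Icc 0 1 (measurable_winProb hL hL').aemeasurable
    (ae_of_all _ fun w => winProb_mem_Icc L L' w)

theorem integral_winProb_mem_Icc {L L' : ∀ j, Set (Ω j)} (hL : ∀ j, MeasurableSet (L j))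
    (hL' : ∀ j, MeasurableSet (L' j)) : ∫ w, winProb L L' w ∂(Measure.pi D) ∈ Set.Icc (0 : ℝ) 1 := by
  refine ⟨integral_nonneg fun w => (winProb_mem_Icc L L' w).1, ?_⟩
  refine (integral_mono (integrable_winProb D hL hL') (integrable_const 1)
    fun w => (winProb_mem_Icc L L' w).2).trans ?_
  simp

theorem integral_winProb_sub_le {A A' B B' : ∀ j, Set (Ω j)} (hA : ∀ j, MeasurableSet (A j))
    (hA' : ∀ j, MeasurableSet (A' j)) (hB : ∀ j, MeasurableSet (B j))
    (hB' : ∀ j, MeasurableSet (B' j)) (h : ∀ j, A j ⊆ B j) (h' : ∀ j, A' j ⊆ B' j) :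
    ∫ w, winProb B B' w ∂(Measure.pi D) - ∫ w, winProb A A' w ∂(Measure.pi D) ≤
      ∑ j, ((D j).real (B j \ A j) + (D j).real (B' j \ A' j)) := by
  have hint : ∀ {j} {E : Set (Ω j)}, MeasurableSet E →
      Integrable (fun w : ∀ j, Ω j => E.indicator (1 : Ω j → ℝ) (w j)) (Measure.pi D) ∧
      ∫ w, E.indicator (1 : Ω j → ℝ) (w j) ∂(Measure.pi D) = (D j).real E := by
    intro j E hE
    have hmp := measurePreserving_eval D j
    have hi : Integrable (E.indicator (1 : Ω j → ℝ)) (D j) := (integrable_const 1).indicator hE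
    refine ⟨hmp.integrable_comp_of_integrable hi, ?_⟩
    rw [← integral_indicator_one hE, ← hmp.map_eq, integral_map hmp.measurable.aemeasurable
      (measurable_one.indicator hE).aestronglyMeasurable]
  rw [← integral_sub (integrable_winProb D hB hB') (integrable_winProb D hA hA')]
  have h1 : ∀ j, Integrable (fun w : ∀ j, Ω j => (B j \ A j).indicator (1 : Ω j → ℝ) (w j) +
      (B' j \ A' j).indicator (1 : Ω j → ℝ) (w j)) (Measure.pi D) := fun j =>
    (hint ((hB j).diff (hA j))).1.add (hint ((hB' j).diff (hA' j))).1
  refine (integral_mono ((integrable_winProb D hB hB').sub (integrable_winProb D hA hA'))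
    (integrable_finsetSum _ fun j _ => h1 j) (winProb_sub_le h h')).trans_eq ?_
  rw [integral_finsetSum _ fun j _ => h1 j]
  refine Finset.sum_congr rfl fun j _ => ?_
  rw [integral_add (hint ((hB j).diff (hA j))).1 (hint ((hB' j).diff (hA' j))).1,
    (hint ((hB j).diff (hA j))).2, (hint ((hB' j).diff (hA' j))).2]

end WinProb

/-! ### Interim utility through the winning probability -/

/-- The numerator tests that nobody outbids `i`; when it is `1`, the denominator counts the tied
highest bidders, `i` included. -/
theorem allocation_combineBids {n : ℕ} {H : ℝ} (i : Fin n) (b : Bid H)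
    {Ω : {j : Fin n // j ≠ i} → Type*} (s : ∀ j, Ω j → Bid H) (w : ∀ j, Ω j) :
    allocation i (combineBids i b fun j => s j (w j)) =
      winProb (fun j => {x | s j x < b}) (fun j => {x | s j x ≤ b}) w := by
  classical
  have hi : combineBids i b (fun j => s j (w j)) i = b := by simp [combineBids]
  have hj : ∀ j : {j : Fin n // j ≠ i}, combineBids i b (fun j => s j (w j)) j = s j (w j) :=
    fun j => by simp [combineBids, j.2]
  have hall : (∀ j, combineBids i b (fun j => s j (w j)) j ≤ b) ↔ ∀ j, s j (w j) ≤ b := by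
    refine ⟨fun h j => hj j ▸ h j, fun h j => ?_⟩
    by_cases hji : j = i
    · rw [hji, hi]
    · rw [hj ⟨j, hji⟩]
      exact h _
  by_cases hle : ∀ j, s j (w j) ≤ b
  · have hmem : i ∈ highestBidders (combineBids i b fun j => s j (w j)) := by
      simpa [highestBidders, hi] using hall.2 hle
    have hcard : ((highestBidders (combineBids i b fun j => s j (w j))).card : ℝ) =
        1 + ∑ j, {x | s j x < b}ᶜ.indicator (1 : Ω j → ℝ) (w j) := by
      rw [highestBidders, Finset.card_filter, Fintype.sum_eq_add_sum_subtype_ne _ i]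
      push_cast
      congr 1
      · rw [if_pos]
        rw [hi]
        exact hall.2 hle
      · refine Finset.sum_congr rfl fun j _ => ?_
        rw [Set.indicator_apply, hj j]
        refine if_congr ⟨fun h => ?_, fun h k => ?_⟩ rfl rfl
        · simpa [hi] using h i
        · refine (hall.2 hle k).trans ?_
          simpa using h
    rw [allocation, if_pos hmem, hcard, winProb]
    congr 1
    refine (Finset.prod_eq_one fun j _ => ?_).symm
    exact Set.indicator_of_mem (show w j ∈ {x | s j x ≤ b} from hle j) _
  · have hmem : i ∉ highestBidders (combineBids i b fun j => s j (w j)) := by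
      simpa [highestBidders, hi] using fun h => hle (hall.1 h)
    rw [allocation, if_neg hmem, winProb]
    push Not at hle
    obtain ⟨j, hjb⟩ := hle
    rw [Finset.prod_eq_zero (Finset.mem_univ j), zero_div]
    exact Set.indicator_of_notMem (by simpa using hjb) _

/-- The interim utility in terms of the winning probability. -/
theorem interimUtility_eq {n : ℕ} {H : ℝ} {T : Fin n → Set ℝ} (P : PaymentRule n H)
    (D : ∀ j, Measure (T j)) [∀ j, IsProbabilityMeasure (D j)] (i : Fin n) (v : T i) (b : Bid H)
    {s : ∀ j : {j : Fin n // j ≠ i}, T j → Bid H} (hs : ∀ j, Monotone (s j)) :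
    interimUtility P D i v b s = ((v : ℝ) - P.f i b) *
      ∫ w, winProb (fun j => {x | s j x < b}) (fun j => {x | s j x ≤ b}) w
        ∂(Measure.pi fun j : {j : Fin n // j ≠ i} => D j) - P.g i b := by
  have hL : ∀ j, MeasurableSet {x | s j x < b} := fun j =>
    IsLowerSet.measurableSet_subtype fun _ _ hyx hx => (hs j hyx).trans_lt hx
  have hL' : ∀ j, MeasurableSet {x | s j x ≤ b} := fun j =>
    IsLowerSet.measurableSet_subtype fun _ _ hyx hx => (hs j hyx).trans hx
  have hb : ∀ w : (∀ j : {j : Fin n // j ≠ i}, T j),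
      combineBids i b (fun j => s j (w j)) i = b := fun w => by simp [combineBids]
  have he : ∀ w : (∀ j : {j : Fin n // j ≠ i}, T j),
      P.exPostUtility i (v : ℝ) (combineBids i b fun j => s j (w j)) =
      ((v : ℝ) - P.f i b) * winProb (fun j => {x | s j x < b}) (fun j => {x | s j x ≤ b}) w
        - P.g i b := fun w => by
    rw [PaymentRule.exPostUtility, PaymentRule.payment, hb, allocation_combineBids]
    ring
  rw [interimUtility]
  simp_rw [he]
  rw [integral_sub ((integrable_winProb _ hL hL').const_mul _) (integrable_const _),
    integral_const_mul]
  simp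

/-! ### Uniform deviation over monotone strategies -/

theorem measurePreserving_pi_subtype {ι : Type*} [Fintype ι] {Ω : ι → Type*}
    [∀ j, MeasurableSpace (Ω j)] (D : ∀ j, Measure (Ω j)) [∀ j, IsProbabilityMeasure (D j)]
    (p : ι → Prop) [DecidablePred p] :
    MeasurePreserving (fun (v : ∀ j, Ω j) (j : Subtype p) => v j) (Measure.pi D)
      (Measure.pi fun j : Subtype p => D j) :=
  measurePreserving_fst.comp (measurePreserving_piEquivPiSubtypeProd D p)

theorem isProbabilityMeasure_empiricalMarginal {n m : ℕ} [NeZero m] {T : Fin n → Set ℝ}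
    (S : Fin m → ValueProfile T) (j : Fin n) : IsProbabilityMeasure (empiricalMarginal S j) := by
  have hm : (m : ENNReal) ≠ 0 := by exact_mod_cast NeZero.ne m
  refine ⟨?_⟩
  simp [empiricalMarginal, ENNReal.inv_mul_cancel hm]

section Deviation

variable {n : ℕ} {T : Fin n → Set ℝ} (D : ∀ j, Measure (T j)) [∀ j, IsProbabilityMeasure (D j)]
  {m : ℕ} [NeZero m]

theorem measureReal_abs_integral_winProb_ge_le (i : Fin n)
    {L L' : ∀ j : {j : Fin n // j ≠ i}, Set (T j)} (hL : ∀ j, MeasurableSet (L j))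
    (hL' : ∀ j, MeasurableSet (L' j)) {η : ℝ} (hη : 0 ≤ η) :
    (Measure.pi fun _ : Fin m => Measure.pi D).real
      {S | η ≤ |∫ w, winProb L L' w
            ∂(Measure.pi fun j : {j : Fin n // j ≠ i} => empiricalMarginal S j) -
          ∫ w, winProb L L' w ∂(Measure.pi fun j : {j : Fin n // j ≠ i} => D j)|} ≤
      2 * Real.exp (-(2 * m * η ^ 2)) := by
  have hrestr : ∀ μ : (∀ j, Measure (T j)), (∀ j, IsProbabilityMeasure (μ j)) →
      ∫ w, winProb L L' w ∂(Measure.pi fun j : {j : Fin n // j ≠ i} => μ j) =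
        ∫ v, winProb L L' (fun j : {j : Fin n // j ≠ i} => v j) ∂(Measure.pi μ) := by
    intro μ hμ
    have hmp := measurePreserving_pi_subtype μ (fun j => j ≠ i)
    rw [← hmp.map_eq, integral_map hmp.measurable.aemeasurable
      (measurable_winProb hL hL').aestronglyMeasurable]
  have hmeas : Measurable fun v : ∀ j, T j =>
      winProb L L' (fun j : {j : Fin n // j ≠ i} => v j) :=
    (measurable_winProb hL hL').comp (by fun_prop)
  have key := measureReal_abs_integral_empirical_ge_le (m := m) D hmeas
    (fun v => winProb_mem_Icc L L' _) hη
  rw [hrestr D inferInstance]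
  simp_rw [fun S : Fin m → ValueProfile T =>
    hrestr (empiricalMarginal S) (isProbabilityMeasure_empiricalMarginal S)]
  exact key

variable {H : ℝ} (P : PaymentRule n H)

theorem measure_exists_deviation_le (hH : 0 < H) (hT : ∀ j, T j ⊆ Set.Icc (0 : ℝ) H) {η : ℝ}
    (hη : 0 < η) {K : ℕ} (hK : 0 < K) (hKη : 2 * (n : ℝ) / K ≤ η / 2) :
    (Measure.pi fun _ : Fin m => Measure.pi D)
      {S | ¬ ∀ s ∈ {s : JointStrategy T H | MonotoneStrategy s}, ∀ (i : Fin n) (v : T i),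
        |empiricalProductEstimator P m S i v s -
          interimUtility P D i v (s i v) (fun j => s j)| < H * η} ≤
      ENNReal.ofReal (4 * n * (K : ℝ) ^ (2 * n) * Real.exp (-(m * η ^ 2 / 2))) := by
  have hKr : (0 : ℝ) < K := by exact_mod_cast hK
  choose A B hA hB hAB hcov using fun j => exists_isLowerSet_brackets (D j) hK
  let G : Bool → ∀ j, Fin K → Set (T j) := fun β j k => if β then B j k else A j k
  have hG : ∀ β j k, MeasurableSet (G β j k) := fun β j k => by
    cases β
    · exact hA j k
    · exact hB j k
  -- A bidder, a bracket for each `L j` and each `L' j`, and the choice of lower or upper ends.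
  -- Indexing also `j = q.1` only overcounts.
  let I := Fin n × (Fin n → Fin K) × (Fin n → Fin K) × Bool
  let F : I → (∀ μ : (∀ j, Measure (T j)), ℝ) := fun q μ =>
    ∫ w, winProb (fun j : {j : Fin n // j ≠ q.1} => G q.2.2.2 j (q.2.1 j))
      (fun j : {j : Fin n // j ≠ q.1} => G q.2.2.2 j (q.2.2.1 j)) w
      ∂(Measure.pi fun j : {j : Fin n // j ≠ q.1} => μ j)
  let bad : I → Set (Fin m → ValueProfile T) := fun q =>
    {S | η / 2 ≤ |F q (empiricalMarginal S) - F q D|}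
  have hbad : ∀ q, (Measure.pi fun _ : Fin m => Measure.pi D) (bad q) ≤
      ENNReal.ofReal (2 * Real.exp (-(m * η ^ 2 / 2))) := by
    intro q
    have h := measureReal_abs_integral_winProb_ge_le (m := m) D q.1
      (fun j => hG q.2.2.2 j (q.2.1 j)) (fun j => hG q.2.2.2 j (q.2.2.1 j)) (half_pos hη).le
    rw [show 2 * (m : ℝ) * (η / 2) ^ 2 = m * η ^ 2 / 2 by ring] at h
    exact (ENNReal.le_ofReal_iff_toReal_le (measure_ne_top _ _) (by positivity)).2 h
  have hsub : {S | ¬ ∀ s ∈ {s : JointStrategy T H | MonotoneStrategy s}, ∀ (i : Fin n) (v : T i),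
        |empiricalProductEstimator P m S i v s -
          interimUtility P D i v (s i v) (fun j => s j)| < H * η} ⊆ ⋃ q, bad q := by
    intro S hS
    by_contra hgood
    refine hS fun s hs i v => ?_
    simp only [bad, Set.mem_iUnion, Set.mem_ofPred_eq, not_exists, not_le, abs_lt] at hgood
    have hE := isProbabilityMeasure_empiricalMarginal S
    rw [empiricalProductEstimator, interimUtility_eq P _ i v _ fun j => hs j,
      interimUtility_eq P D i v _ fun j => hs j]
    set b := s i v
    let L : ∀ j, Set (T j) := fun j => {x | s j x < b}
    let L' : ∀ j, Set (T j) := fun j => {x | s j x ≤ b}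
    have hL : ∀ j, IsLowerSet (L j) := fun j _ _ hyx hx => (hs j hyx).trans_lt hx
    have hL' : ∀ j, IsLowerSet (L' j) := fun j _ _ hyx hx => (hs j hyx).trans hx
    choose k hk1 hk2 using fun j => hcov j (L j) (hL j)
    choose k' hk1' hk2' using fun j => hcov j (L' j) (hL' j)
    let W : (∀ j, Measure (T j)) → ℝ := fun μ =>
      ∫ w, winProb (fun j : {j : Fin n // j ≠ i} => L j) (fun j : {j : Fin n // j ≠ i} => L' j) w
        ∂(Measure.pi fun j : {j : Fin n // j ≠ i} => μ j)
    have hlow : ∀ μ : (∀ j, Measure (T j)), (∀ j, IsProbabilityMeasure (μ j)) →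
        F (i, k, k', false) μ ≤ W μ := fun μ hμ =>
      integral_mono (integrable_winProb _ (fun j => hA j _) (fun j => hA j _))
        (integrable_winProb _ (fun j => (hL j).measurableSet_subtype)
          (fun j => (hL' j).measurableSet_subtype))
        (winProb_mono (fun j => hk1 j) (fun j => hk1' j))
    have hupp : ∀ μ : (∀ j, Measure (T j)), (∀ j, IsProbabilityMeasure (μ j)) →
        W μ ≤ F (i, k, k', true) μ := fun μ hμ =>
      integral_mono (integrable_winProb _ (fun j => (hL j).measurableSet_subtype)
          (fun j => (hL' j).measurableSet_subtype))
        (integrable_winProb _ (fun j => hB j _) (fun j => hB j _))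
        (winProb_mono (fun j => hk2 j) (fun j => hk2' j))
    -- The gap is needed only under `D`; under the empirical marginals monotonicity suffices.
    have hgap : F (i, k, k', true) D - F (i, k, k', false) D ≤ η / 2 := by
      refine (integral_winProb_sub_le (fun j : {j : Fin n // j ≠ i} => D j) (fun j => hA j _) (fun j => hA j _) (fun j => hB j _)
        (fun j => hB j _) (fun j => (hk1 j).trans (hk2 j))
        (fun j => (hk1' j).trans (hk2' j))).trans ?_
      refine (Finset.sum_le_sum fun (j : {j : Fin n // j ≠ i}) _ =>
        add_le_add (hAB j _) (hAB j _)).trans ?_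
      refine le_trans ?_ hKη
      rw [Finset.sum_const, nsmul_eq_mul, Finset.card_univ]
      have hc : (Fintype.card {j : Fin n // j ≠ i} : ℝ) ≤ n := by
        exact_mod_cast (Fintype.card_subtype_le _).trans_eq (Fintype.card_fin n)
      calc (Fintype.card {j : Fin n // j ≠ i} : ℝ) * (1 / K + 1 / K)
          ≤ n * (1 / K + 1 / K) := by gcongr
        _ = 2 * (n : ℝ) / K := by ring
    -- Sandwich: half of `η` comes from the deviation at a bracket end, half from the gap.
    have hdiff : |W (empiricalMarginal S) - W D| < η := by
      have h1 := hgood (i, k, k', true)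
      have h2 := hgood (i, k, k', false)
      have h3 := hlow D inferInstance
      have h4 := hlow _ hE
      have h5 := hupp D inferInstance
      have h6 := hupp _ hE
      rw [abs_lt]
      constructor <;> linarith [h1.1, h1.2, h2.1, h2.2]
    have hv := hT i v.2
    have hf := P.f_mem i b
    have habs : |(v : ℝ) - P.f i b| ≤ H := abs_sub_le_iff.2
      ⟨by linarith [hv.2, hf.1], by linarith [hv.1, hf.2]⟩
    calc _ = |((v : ℝ) - P.f i b) * (W (empiricalMarginal S) - W D)| := by
          congr 1
          simp only [W, L, L']
          ring
      _ = |(v : ℝ) - P.f i b| * |W (empiricalMarginal S) - W D| := abs_mul _ _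
      _ ≤ H * |W (empiricalMarginal S) - W D| := by gcongr
      _ < H * η := by gcongr
  refine (measure_mono hsub).trans ((measure_iUnion_fintype_le _ _).trans
    ((Finset.sum_le_sum fun q _ => hbad q).trans_eq ?_))
  rw [Finset.sum_const, nsmul_eq_mul, Finset.card_univ, ← ENNReal.ofReal_natCast,
    ← ENNReal.ofReal_mul (by positivity)]
  congr 1
  simp only [I, Fintype.card_prod, Fintype.card_fun, Fintype.card_fin, Fintype.card_bool]
  push_cast
  ring

/-- Settles the case `H < ε`, where the bracket count is not controlled by `max 1 (log (H / ε))`. -/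
theorem abs_interimUtility_sub_le (hH : 0 < H) (hT : ∀ j, T j ⊆ Set.Icc (0 : ℝ) H)
    (S : Fin m → ValueProfile T) {s : JointStrategy T H} (hs : MonotoneStrategy s) (i : Fin n)
    (v : T i) :
    |empiricalProductEstimator P m S i v s -
      interimUtility P D i v (s i v) (fun j => s j)| ≤ H := by
  have hE := isProbabilityMeasure_empiricalMarginal S
  have hL : ∀ j : {j : Fin n // j ≠ i}, MeasurableSet {x | s j x < s i v} := fun j =>
    IsLowerSet.measurableSet_subtype fun _ _ hyx hx => (hs j hyx).trans_lt hx
  have hL' : ∀ j : {j : Fin n // j ≠ i}, MeasurableSet {x | s j x ≤ s i v} := fun j =>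
    IsLowerSet.measurableSet_subtype fun _ _ hyx hx => (hs j hyx).trans hx
  rw [empiricalProductEstimator, interimUtility_eq P _ i v _ fun j => hs j,
    interimUtility_eq P D i v _ fun j => hs j, sub_sub_sub_cancel_right, ← mul_sub, abs_mul]
  have h1 := integral_winProb_mem_Icc
    (fun j : {j : Fin n // j ≠ i} => empiricalMarginal S j) hL hL'
  have h2 := integral_winProb_mem_Icc (fun j : {j : Fin n // j ≠ i} => D j) hL hL'
  have hv := hT i v.2
  have hf := P.f_mem i (s i v)
  refine (mul_le_mul (abs_sub_le_iff.2 ⟨by linarith [hv.2, hf.1], by linarith [hv.1, hf.2]⟩)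
    (abs_sub_le_iff.2 ⟨?_, ?_⟩) (abs_nonneg _) hH.le).trans_eq (mul_one H)
  · linarith [h1.2, h2.1]
  · linarith [h1.1, h2.2]

end Deviation

/-! ### Degenerate case, sample count and conclusion -/

theorem interimUtility_congr_of_le_one {n : ℕ} (hn : n ≤ 1) {H : ℝ} {T : Fin n → Set ℝ}
    (P : PaymentRule n H) (D D' : ∀ j, Measure (T j)) (i : Fin n) (v : T i) (b : Bid H)
    (s : ∀ j : {j : Fin n // j ≠ i}, T j → Bid H) :
    interimUtility P D i v b s = interimUtility P D' i v b s := by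
  have : (fun j : {j : Fin n // j ≠ i} => D j) = fun j : {j : Fin n // j ≠ i} => D' j :=
    funext fun j => (j.2 (Fin.ext (by omega))).elim
  rw [interimUtility, interimUtility, this]

/-- The number of samples makes the union bound over the brackets at most `δ`. -/
theorem union_bound_le {n : ℕ} (hn : 2 ≤ n) {η δ : ℝ} (hη : 0 < η) (hη1 : η ≤ 1) (hδ : 0 < δ)
    (hδ1 : δ < 1) {m : ℝ}
    (hm : 28 * (1 / η ^ 2 * (n * Real.log n * max 1 (Real.log (1 / η)) + Real.log (n / δ))) ≤ m) :
    4 * n * (⌈4 * n / η⌉₊ : ℝ) ^ (2 * n) * Real.exp (-(m * η ^ 2 / 2)) ≤ δ := by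
  have hn2 : (2 : ℝ) ≤ n := by exact_mod_cast hn
  have hn0 : (0 : ℝ) < n := by linarith
  set ℓ := max 1 (Real.log (1 / η))
  have hl1 : 1 ≤ ℓ := le_max_left _ _
  have hlη : Real.log (1 / η) ≤ ℓ := le_max_right _ _
  have hlogn : 1 / 2 ≤ Real.log n :=
    (by linarith [Real.log_two_gt_d9] : (1 / 2 : ℝ) ≤ Real.log 2).trans
      (Real.log_le_log two_pos hn2)
  have hlog2 : Real.log 2 ≤ Real.log n := Real.log_le_log two_pos hn2
  have hK0 : (0 : ℝ) < ⌈4 * n / η⌉₊ := by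
    exact_mod_cast Nat.ceil_pos.2 (by positivity)
  have hK : (⌈4 * n / η⌉₊ : ℝ) ≤ 8 * n * (1 / η) := by
    refine (Nat.ceil_lt_add_one (by positivity)).le.trans ?_
    have : 1 ≤ n * (1 / η) := by
      have : 1 ≤ 1 / η := (one_le_div hη).2 hη1
      nlinarith
    rw [show 4 * n / η = 4 * (n * (1 / η)) by ring]
    linarith
  -- `log K ≤ 3 log 2 + log n + log (1 / η) ≤ 4 log n + ℓ`, and `ℓ ≤ 2 ℓ log n` because `log n ≥ 1 /
  -- 2`.
  have hlogK : Real.log ⌈4 * n / η⌉₊ ≤ 6 * (Real.log n * ℓ) := by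
    refine (Real.log_le_log hK0 hK).trans ?_
    rw [Real.log_mul (by positivity) (by positivity), Real.log_mul (by norm_num) hn0.ne',
      show (8 : ℝ) = 2 ^ 3 by norm_num, Real.log_pow]
    push_cast
    nlinarith
  have hlog4 : Real.log (4 * n) - Real.log δ ≤ 2 * Real.log n + Real.log (n / δ) := by
    rw [Real.log_div hn0.ne' hδ.ne', Real.log_mul (by norm_num) hn0.ne',
      show (4 : ℝ) = 2 ^ 2 by norm_num, Real.log_pow]
    push_cast
    linarith
  have hm' : 14 * (n * Real.log n * ℓ + Real.log (n / δ)) ≤ m * η ^ 2 / 2 := by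
    have : 28 * (1 / η ^ 2 * (n * Real.log n * ℓ + Real.log (n / δ))) * η ^ 2 ≤ m * η ^ 2 := by
      gcongr
    have e : 28 * (1 / η ^ 2 * (n * Real.log n * ℓ + Real.log (n / δ))) * η ^ 2 =
        28 * (n * Real.log n * ℓ + Real.log (n / δ)) := by
      field_simp
    linarith
  have hnδ : 0 ≤ Real.log (n / δ) :=
    Real.log_nonneg ((one_le_div hδ).2 (by linarith))
  rw [← Real.log_le_log_iff (by positivity) hδ, Real.log_mul (by positivity) (Real.exp_pos _).ne',
    Real.log_mul (by positivity) (by positivity), Real.log_exp, Real.log_pow]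
  push_cast
  have h1 : 2 * n * Real.log ⌈4 * n / η⌉₊ ≤ 2 * n * (6 * (Real.log n * ℓ)) := by gcongr
  have h2 : 2 * Real.log n ≤ n * Real.log n * ℓ := by
    calc 2 * Real.log n = 2 * Real.log n * 1 := by ring
      _ ≤ n * Real.log n * ℓ := by gcongr
  have h3 : 0 ≤ n * Real.log n * ℓ := by positivity
  -- The brackets cost `12 n log n · ℓ` and the prefactor `4n / δ` at most `n log n · ℓ + log (n /
  -- δ)`, within the factor `14`.
  nlinarith

end

theorem mainTheorem4 :
    ∃ C : ℝ, 0 < C ∧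
      ∀ (n : ℕ) (H ε δ : ℝ), 1 ≤ n → 0 < H → 0 < ε → 0 < δ → δ < 1 →
      ∃ M : ℝ,
        M ≤ C * (H ^ 2 / ε ^ 2 *
          (n * Real.log n * max 1 (Real.log (H / ε)) + Real.log (n / δ))) ∧
        ∀ T : Fin n → Set ℝ, (∀ j, T j ⊆ Set.Icc (0 : ℝ) H) →
        ∀ P : PaymentRule n H, ∀ m : ℕ, M ≤ m →
          EstimatesUtilities P (empiricalProductEstimator (T := T) P m) ε δ
            {s | MonotoneStrategy s} := by
  refine ⟨28, by norm_num, fun n H ε δ hn hH hε hδ hδ1 => ⟨_, le_rfl, ?_⟩⟩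
  intro T hT P m hm D hD
  have hn0 : (1 : ℝ) ≤ n := by exact_mod_cast hn
  -- A lone bidder has no opponents to estimate, so the error is zero for every `m`, even `m = 0`.
  rcases hn.eq_or_lt with rfl | hn2
  · refine (measure_mono_null (t := ∅) (fun S hS => ?_) measure_empty).le.trans zero_le
    refine hS fun s _ i v => ?_
    rw [empiricalProductEstimator,
      interimUtility_congr_of_le_one le_rfl P (empiricalMarginal S) D, sub_self, abs_zero]
    exact hε
  have hm0 : m ≠ 0 := by
    rintro rfl
    have h1 : 0 < Real.log (n / δ) := Real.log_pos ((one_lt_div hδ).2 (by linarith))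
    have h2 : 0 ≤ Real.log n := Real.log_nonneg hn0
    have : 0 < 28 * (H ^ 2 / ε ^ 2 *
        (n * Real.log n * max 1 (Real.log (H / ε)) + Real.log (n / δ))) := by positivity
    push_cast at hm
    linarith
  have : NeZero m := ⟨hm0⟩
  rcases lt_or_ge H ε with hHε | hHε
  · refine (measure_mono_null (t := ∅) (fun S hS => ?_) measure_empty).le.trans zero_le
    refine hS fun s hs i v => ?_
    exact (abs_interimUtility_sub_le D P hH hT S hs i v).trans_lt hHε
  have hη : 0 < ε / H := div_pos hε hH
  have hHη : H * (ε / H) = ε := by field_simp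
  have hceil : 0 < ⌈4 * n / (ε / H)⌉₊ := Nat.ceil_pos.2 (by positivity)
  -- With `η = ε / H`, `K = ⌈4n / η⌉₊` is the least integer for which the gap `2n / K` is at most `η
  -- / 2`.
  have key := measure_exists_deviation_le (m := m) D P hH hT hη hceil (by
    have h1 : 4 * n / (ε / H) ≤ ⌈4 * n / (ε / H)⌉₊ := Nat.le_ceil _
    rw [div_le_iff₀ (by exact_mod_cast hceil)]
    rw [div_le_iff₀ hη] at h1
    linarith)
  rw [hHη] at key
  refine key.trans (ENNReal.ofReal_le_ofReal ?_)
  refine union_bound_le hn2 hη ((div_le_one hH).2 hHε) hδ hδ1 ?_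
  rw [one_div_div, show 1 / (ε / H) ^ 2 = H ^ 2 / ε ^ 2 by field_simp]
  exact hm
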